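/- Let $M$ be a monoid and let $\tau$ be any topology on its underlying set (no compatibility between $\tau$ and the multiplication is assumed). Let $\mathrm{PSh}(M)$ be the category of right $M$-sets (presheaves of sets on the one-object category $M$), and let $\mathrm{Cont}(M,\tau)$ be its full subcategory on the $(M,\tau)$-sets, i.e. those $X$ whose action $X\times M\to X$ is continuous when $X$ is discrete, $M$ carries $\tau$, and $X\times M$ carries the product topology. Let $V:\mathrm{Cont}(M,\tau)\to\mathrm{PSh}(M)$ be the forgetful functor. For an $M$-set $X$, $x\in X$ and $p\in M$ put $\mathcal I_x^p=\{m\in M\mid xm=xp\}$ and $\mathfrak r_x=\{(p,q)\in M\times M\mid xp=xq\}$. Then: 1. $V$ is left exact and comonadic. Its right adjoint $R$ sends an $M$-set $X$ to its sub-$M$-set of continuous elements $$R(X)=\{x\in X\mid \forall p,q\in M,\ \mathcal I_{xq}^p\in\tau\}=\{x\in X\mid\forall q\in M,\ \mathfrak r_{xq}\text{ is open in }M\times M\},$$ with counit the inclusion $R(X)\hookrightarrow X$. If moreover for every $q\in M$ the left multiplication $m\mapsto qm$ is continuous for $\tau$, then $$R(X)=\{x\in X\mid\forall p\in M,\ \mathcal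 I_x^p\in\tau\}=\{x\in X\mid\mathfrak r_x\text{ is open in }M\times M\}.$$ 2. $\mathrm{Cont}(M,\tau)$ is an elementary topos, and the geometric morphism $\mathrm{PSh}(M)\to\mathrm{Cont}(M,\tau)$ with inverse image $V$ and direct image $R$ is hyperconnected: $V$ is full and faithful, and its image is closed under subobjects and quotients in $\mathrm{PSh}(M)$. 3. $\mathrm{Cont}(M,\tau)$ is a Grothendieck topos (equivalent to the category of sheaves of sets on a small site). It is supercompactly generated: its supercompact objects, i.e. those $C$ such that every jointly epic family $\{A_i\to C\mid i\in I\}$ contains an epimorphism, form up to isomorphism a set, and this set is separating. It is two-valued: it has exactly two subterminal objects up to isomorphism. It has enough points: there is a set of geometric morphisms $\mathbf{Set}\to\mathrm{Cont}(M,\tau)$ whose inverse image functors are jointly conservative. -/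

import Mathlib

open CategoryTheory CategoryTheory.Limits Opposite

universe u v w u₁ v₁ u₂ v₂

/-! ### Topos-theoretic notions -/

/-- An elementary topos: finite limits, cartesian closed, with a subobject classifier. -/
structure IsElementaryTopos (E : Type w) [Category.{v} E] : Prop where
  hasFiniteLimits : HasFiniteLimits E
  cartesianClosed : ∃ _ : CartesianMonoidalCategory E, Nonempty (MonoidalClosed E)
  hasSubobjectClassifier : HasSubobjectClassifier E

/-- A Grothendieck topos: a category equivalent to the category of sheaves of sets on a
small site. -/
def IsGrothendieckTopos (E : Type w) [Category.{v} E] : Prop :=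
  ∃ (C : Type v) (_ : SmallCategory C) (J : GrothendieckTopology C),
    Nonempty (E ≌ Sheaf J (Type v))

/-- A topos is two-valued if it has exactly two subterminal objects (up to isomorphism). -/
def IsTwoValued (E : Type w) [Category.{v} E] : Prop :=
  ∃ T : E, Nonempty (IsTerminal T) ∧ Nat.card (Subobject T) = 2

/-- A family of morphisms with common codomain is jointly epic. -/
def JointlyEpic {E : Type w} [Category.{v} E] {I : Type u} {A : I → E} {C : E}
    (f : ∀ i, A i ⟶ C) : Prop :=
  ∀ ⦃Z : E⦄ (g h : C ⟶ Z), (∀ i, f i ≫ g = f i ≫ h) → g = h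

/-- An object is supercompact if every (small) jointly epic family of morphisms into it
contains an epimorphism. -/
def supercompact (E : Type w) [Category.{v} E] : ObjectProperty E := fun C =>
  ∀ (I : Type v) (A : I → E) (f : ∀ i, A i ⟶ C), JointlyEpic f → ∃ i, Epi (f i)

/-- A topos is supercompactly generated if its supercompact objects form, up to isomorphism,
a set, and this set is separating. -/
structure IsSupercompactlyGenerated (E : Type w) [Category.{v} E] : Prop where
  essentiallySmall : ObjectProperty.EssentiallySmall.{v} (supercompact E)
  isSeparating : (supercompact E).IsSeparating

/-- A geometric morphism `F ⟶ E`: a direct image functor `F ⥤ E` with a left exact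
left adjoint, the inverse image functor. -/
structure GeometricMorphism (F : Type u₁) [Category.{v₁} F] (E : Type u₂) [Category.{v₂} E] where
  direct : F ⥤ E
  inverse : E ⥤ F
  adj : inverse ⊣ direct
  leftExact : PreservesFiniteLimits inverse

/-- A geometric morphism is hyperconnected if its inverse image functor is full and faithful,
with image closed under subobjects and quotients. -/
structure GeometricMorphism.IsHyperconnected {F : Type u₁} [Category.{v₁} F]
    {E : Type u₂} [Category.{v₂} E] (f : GeometricMorphism F E) : Prop where
  full : f.inverse.Full
  faithful : f.inverse.Faithful
  subobjects : ∀ (X : E) (A : F) (i : A ⟶ f.inverse.obj X), Mono i → f.inverse.essImage A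
  quotients : ∀ (X : E) (A : F) (p : f.inverse.obj X ⟶ A), Epi p → f.inverse.essImage A

/-- A topos has enough points if there is a set of points, that is, of geometric morphisms
from the topos of sets, whose inverse image functors are jointly conservative. -/
def HasEnoughPoints (E : Type w) [Category.{v} E] : Prop :=
  ∃ (I : Type v) (p : I → GeometricMorphism (Type v) E),
    JointlyReflectIsomorphisms (fun i => (p i).inverse)

/-! ### Continuous actions of a monoid equipped with a topology -/

/-- The category of right `M`-sets, as presheaves on the one-object category `M`. -/
abbrev PSh (M : Type u) [Monoid M] : Type (u + 1) := (SingleObj M)ᵒᵖ ⥤ Type u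

namespace PSh

variable {M : Type u} [Monoid M]

/-- The underlying set of a right `M`-set. -/
abbrev carrier (X : PSh M) : Type u := X.obj (op (SingleObj.star M))

/-- The right action `(x, m) ↦ xm`. -/
def act (X : PSh M) (x : X.carrier) (m : M) : X.carrier :=
  X.map (Quiver.Hom.op (SingleObj.toEnd M m)) x

theorem act_one (X : PSh M) (x : X.carrier) : X.act x 1 = x :=
  Functor.map_id_apply X _ x

theorem act_mul (X : PSh M) (x : X.carrier) (m n : M) :
    X.act x (m * n) = X.act (X.act x m) n :=
  Functor.map_comp_apply X (Quiver.Hom.op (SingleObj.toEnd M m))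
    (Quiver.Hom.op (SingleObj.toEnd M n)) x

theorem map_act {X Y : PSh M} (f : X ⟶ Y) (x : X.carrier) (m : M) :
    f.app (op (SingleObj.star M)) (X.act x m) = Y.act (f.app (op (SingleObj.star M)) x) m :=
  NatTrans.naturality_apply f (Quiver.Hom.op (SingleObj.toEnd M m)) x

/-- The necessary clopen `I_x^p = {m | xm = xp}`. -/
def necessaryClopen (X : PSh M) (x : X.carrier) (p : M) : Set M :=
  {m | X.act x m = X.act x p}

/-- The equivalence relation `r_x = {(p, q) | xp = xq}` on `M`. -/
def rel (X : PSh M) (x : X.carrier) : Set (M × M) :=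
  {pq | X.act x pq.1 = X.act x pq.2}

/-- A right `M`-set is continuous if its action map `X × M → X` is continuous, where `X` has
the discrete topology and `X × M` the product topology. -/
def isContinuous (M : Type u) [Monoid M] [TopologicalSpace M] : ObjectProperty (PSh M) :=
  fun X =>
    letI : TopologicalSpace X.carrier := ⊥
    Continuous (fun p : X.carrier × M => X.act p.1 p.2)

variable [TopologicalSpace M]

/-- The `M`-subset of continuous elements of `X`: those `x` such that `I_{xq}^p` is open for
all `p` and `q`. -/
def contElements (X : PSh M) : Subfunctor X where
  obj _ := {x : X.carrier | ∀ p q : M, IsOpen (X.necessaryClopen (X.act x q) p)}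
  map {U V} i := by
    intro x hx p q
    have h := hx p (i.unop * q)
    rw [act_mul] at h
    exact h

theorem isContinuous_contElements (X : PSh M) :
    isContinuous M X.contElements.toFunctor := by
  let Y : PSh M := X.contElements.toFunctor
  let _ : TopologicalSpace Y.carrier := ⊥
  have : DiscreteTopology Y.carrier := ⟨rfl⟩
  refine continuous_prod_of_discrete_left.mpr fun y => ?_
  refine continuous_discrete_rng.mpr fun z => isOpen_iff_forall_mem_open.mpr fun m hm => ?_
  refine ⟨X.necessaryClopen (X.act y.1 1) m, fun n hn => ?_, y.2 m 1, rfl⟩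
  have hn' : X.act (X.act y.1 1) n = X.act (X.act y.1 1) m := hn
  rw [act_one] at hn'
  exact Subtype.ext (hn'.trans (congrArg Subtype.val hm))

theorem map_mem_contElements {X Y : PSh M} (f : X ⟶ Y) (x : X.carrier)
    (hx : x ∈ X.contElements.obj (op (SingleObj.star M))) :
    f.app (op (SingleObj.star M)) x ∈ Y.contElements.obj (op (SingleObj.star M)) := by
  intro p q
  refine isOpen_iff_forall_mem_open.mpr fun m hm => ?_
  refine ⟨X.necessaryClopen (X.act x q) m, fun n hn => ?_, hx m q, rfl⟩
  have hn' : X.act (X.act x q) n = X.act (X.act x q) m := hn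
  have h := congrArg (f.app (op (SingleObj.star M))) hn'
  rw [map_act, map_act, map_act, map_act] at h
  exact h.trans hm

end PSh

/-- The category of continuous right `M`-sets, a full subcategory of `PSh M`. -/
abbrev ContSets (M : Type u) [Monoid M] [TopologicalSpace M] : Type (u + 1) :=
  (PSh.isContinuous M).FullSubcategory

namespace ContSets

variable (M : Type u) [Monoid M] [TopologicalSpace M]

/-- The forgetful functor from continuous `M`-sets to `M`-sets. -/
abbrev V : ContSets M ⥤ PSh M := (PSh.isContinuous M).ι

/-- The functor sending an `M`-set to its continuous elements, and restricting morphisms. -/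
def R : PSh M ⥤ ContSets M where
  obj X := ⟨X.contElements.toFunctor, X.isContinuous_contElements⟩
  map {X Y} f := ObjectProperty.homMk
    { app := fun U => ↾fun x => ⟨f.app U x.1, PSh.map_mem_contElements f x.1 x.2⟩
      naturality := fun U V i => by
        refine ConcreteCategory.hom_ext _ _ fun x => Subtype.ext ?_
        exact NatTrans.naturality_apply f i (Subtype.val x) }

end ContSets

/-! An `M`-set is continuous exactly when all its classes `{m | xm = xp}` are open. Passing to a
sub-`M`-set leaves these classes unchanged, passing to a quotient replaces them by unions, and
finite limits give finite intersections. Hence `V` is left exact with image closed under subobjects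
and quotients. The continuous elements form the largest continuous sub-`M`-set, so `V` is the
inclusion of a coreflective full subcategory, and therefore comonadic. The underlying set functor is
a single conservative point, so epimorphisms are surjections and monomorphisms are injections.

Up to isomorphism the supercompact objects are the cyclic sets `M / r`, with `r` in the set
`ContCongr M`: a jointly epic family must hit the generator, and a supercompact object is one of its
own orbits. These cyclic sets, covered by single surjections, form a site. The functor `nerve`, `X ↦
Hom(M / r, X)`, is an equivalence onto sheaves: elements of `X` are recovered from orbit maps, and a
sheaf `P` comes from the `M`-set `glue P` of germs of its sections under refinement of congruences.
The elementary topos structure is transported along this equivalence. -/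

namespace PSh

variable {M : Type u} [Monoid M]

/-- The right `M`-set given by an explicit right action. -/
def ofAct (X : Type u) (a : X → M → X) (one : ∀ x, a x 1 = x)
    (mul : ∀ x m n, a x (m * n) = a (a x m) n) : PSh M where
  obj _ := X
  map f := ↾fun x => a x f.unop
  map_id _ := ConcreteCategory.hom_ext _ _ fun x => one x
  map_comp f g := ConcreteCategory.hom_ext _ _ fun x => mul x f.unop g.unop

/-- The morphism of right `M`-sets given by an equivariant function. -/
def ofEquivariant {X Y : PSh M} (f : X.carrier → Y.carrier)
    (hf : ∀ x m, f (X.act x m) = Y.act (f x) m) : X ⟶ Y where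
  app _ := ↾f
  naturality _ _ i := ConcreteCategory.hom_ext _ _ fun x => hf x i.unop

/-- The function underlying a morphism of right `M`-sets. -/
abbrev toFun {X Y : PSh M} (f : X ⟶ Y) : X.carrier → Y.carrier :=
  f.app (op (SingleObj.star M))

theorem toFun_act {X Y : PSh M} (f : X ⟶ Y) (x : X.carrier) (m : M) :
    toFun f (X.act x m) = Y.act (toFun f x) m :=
  map_act f x m

theorem hom_ext_of_toFun {X Y : PSh M} {f g : X ⟶ Y} (h : ∀ x, toFun f x = toFun g x) : f = g := by
  ext ⟨⟨⟩⟩ x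
  exact h x

theorem injective_of_mono {X Y : PSh M} (f : X ⟶ Y) [Mono f] :
    Function.Injective (toFun f) :=
  (mono_iff_injective _).1 inferInstance

theorem surjective_of_epi {X Y : PSh M} (f : X ⟶ Y) [Epi f] :
    Function.Surjective (toFun f) :=
  (epi_iff_surjective _).1 inferInstance

theorem isIso_of_isIso_app {X Y : PSh M} (f : X ⟶ Y)
    [IsIso (f.app (op (SingleObj.star M)))] : IsIso f := by
  have : ∀ U, IsIso (f.app U) := fun _ => ‹_›
  exact NatIso.isIso_of_isIso_app f

/-! ### Openness of the classes, and closure properties of continuous `M`-sets -/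

section Topology

variable [TopologicalSpace M]

/-- Since `X` is discrete, continuity is tested on each map `m ↦ xm`, whose nonempty fibres are the
classes. No translates `xq` are needed because `x` runs over all of `X`. -/
theorem isContinuous_iff (X : PSh M) :
    isContinuous M X ↔ ∀ (x : X.carrier) (p : M), IsOpen (X.necessaryClopen x p) := by
  let _ : TopologicalSpace X.carrier := ⊥
  have : DiscreteTopology X.carrier := ⟨rfl⟩
  refine continuous_prod_of_discrete_left.trans (forall_congr' fun x => ?_)
  refine continuous_discrete_rng.trans ⟨fun h p => h (X.act x p), fun h z => ?_⟩
  refine isOpen_iff_forall_mem_open.mpr fun m hm => ⟨X.necessaryClopen x m, fun n hn => ?_, h m, rfl⟩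
  exact Eq.trans (show X.act x n = X.act x m from hn) hm

theorem isOpen_necessaryClopen_of_isContinuous {X : PSh M} (hX : isContinuous M X)
    (x : X.carrier) (p : M) : IsOpen (X.necessaryClopen x p) :=
  (isContinuous_iff X).1 hX x p

theorem mem_contElements_of_isContinuous {X : PSh M} (hX : isContinuous M X) (x : X.carrier) :
    x ∈ X.contElements.obj (op (SingleObj.star M)) :=
  fun p q => isOpen_necessaryClopen_of_isContinuous hX (X.act x q) p

/-- Equivariance makes each class of `f x` a union of classes of `x`. -/
theorem isOpen_necessaryClopen_map {X Y : PSh M} (f : X ⟶ Y) {x : X.carrier}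
    (hx : ∀ p, IsOpen (X.necessaryClopen x p)) (p : M) :
    IsOpen (Y.necessaryClopen (toFun f x) p) := by
  refine isOpen_iff_forall_mem_open.mpr fun m hm =>
    ⟨X.necessaryClopen x m, fun n hn => ?_, hx m, rfl⟩
  have h := congrArg (toFun f) (show X.act x n = X.act x m from hn)
  rw [toFun_act, toFun_act] at h
  exact h.trans hm

theorem isContinuous_of_surjective {X Y : PSh M} (f : X ⟶ Y) (hf : Function.Surjective (toFun f))
    (hX : isContinuous M X) : isContinuous M Y := by
  refine (isContinuous_iff Y).2 fun y p => ?_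
  obtain ⟨x, rfl⟩ := hf y
  exact isOpen_necessaryClopen_map f (isOpen_necessaryClopen_of_isContinuous hX x) p

theorem isContinuous_of_injective {X Y : PSh M} (f : X ⟶ Y) (hf : Function.Injective (toFun f))
    (hY : isContinuous M Y) : isContinuous M X := by
  refine (isContinuous_iff X).2 fun x p => ?_
  convert isOpen_necessaryClopen_of_isContinuous hY (toFun f x) p using 1
  ext m
  exact hf.eq_iff.symm.trans (by rw [toFun_act, toFun_act]; rfl)

instance isClosedUnderLimitsOfShape_isContinuous (J : Type) [SmallCategory J] [FinCategory J] :
    (isContinuous M).IsClosedUnderLimitsOfShape J where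
  limitsOfShape_le := by
    rintro X ⟨h⟩
    refine (isContinuous_iff X).2 fun x p => ?_
    have hl := isLimitOfPreserves ((evaluation _ (Type u)).obj (op (SingleObj.star M))) h.isLimit
    -- Elements of a limit are equal when all their projections are, and the diagram is finite.
    have : X.necessaryClopen x p =
        ⋂ j, (h.diag.obj j).necessaryClopen (toFun (h.π.app j) x) p := by
      ext m
      refine ⟨fun hm => Set.mem_iInter.2 fun j => ?_, fun hm => ?_⟩
      · have h' := congrArg (toFun (h.π.app j)) (show X.act x m = X.act x p from hm)
        exact (toFun_act (h.π.app j) x m).symm.trans (h'.trans (toFun_act (h.π.app j) x p))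
      · refine Concrete.isLimit_ext _ hl _ _ fun j => ?_
        refine (toFun_act (h.π.app j) x m).trans (Eq.trans ?_ (toFun_act (h.π.app j) x p).symm)
        exact Set.mem_iInter.1 hm j
    rw [this]
    exact isOpen_iInter_of_finite fun j =>
      isOpen_necessaryClopen_of_isContinuous (h.prop_diag_obj j) _ p

/-- An equivalence relation contains the product of the classes of any related pair; conversely each
class is a slice of the relation. -/
theorem mem_contElements_iff_rel (X : PSh M) (x : X.carrier) :
    x ∈ X.contElements.obj (op (SingleObj.star M)) ↔ ∀ q : M, IsOpen (X.rel (X.act x q)) := by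
  refine ⟨fun h q => isOpen_iff_forall_mem_open.mpr fun m hm => ?_, fun h p q => ?_⟩
  · refine ⟨X.necessaryClopen (X.act x q) m.1 ×ˢ X.necessaryClopen (X.act x q) m.2, ?_,
      (h m.1 q).prod (h m.2 q), rfl, rfl⟩
    rintro ⟨a, b⟩ ⟨ha, hb⟩
    exact Eq.trans ha (Eq.trans hm (Eq.symm hb))
  · exact (h q).preimage (f := fun m => (m, p)) (by fun_prop)

theorem mem_contElements_iff_of_continuous_mul (hM : ∀ q : M, Continuous fun m : M => q * m)
    (X : PSh M) (x : X.carrier) :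
    x ∈ X.contElements.obj (op (SingleObj.star M)) ↔ ∀ p : M, IsOpen (X.necessaryClopen x p) := by
  refine ⟨fun h p => by simpa only [act_one] using h p 1, fun h p q => ?_⟩
  -- The class of `p` for `xq` is the preimage under `q * ·` of the class of `q * p` for `x`.
  convert (h (q * p)).preimage (hM q) using 1
  ext m
  simp only [necessaryClopen, Set.mem_ofPred_eq, Set.mem_preimage, act_mul]

theorem mem_contElements_iff_isOpen_rel (hM : ∀ q : M, Continuous fun m : M => q * m)
    (X : PSh M) (x : X.carrier) :
    x ∈ X.contElements.obj (op (SingleObj.star M)) ↔ IsOpen (X.rel x) := by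
  refine ⟨fun h => by simpa only [act_one] using (mem_contElements_iff_rel X x).1 h 1, fun h => ?_⟩
  refine (mem_contElements_iff_of_continuous_mul hM X x).2 fun p => ?_
  exact h.preimage (f := fun m => (m, p)) (by fun_prop)

end Topology

end PSh

/-! ### The coreflection, hyperconnectedness and the canonical point -/

namespace ContSets

variable (M : Type u) [Monoid M] [TopologicalSpace M]

/-- The forgetful functor is left adjoint to the functor of continuous elements. -/
def adjunction : V M ⊣ R M :=
  Adjunction.mkOfUnitCounit
    { unit :=
        { app := fun X => ObjectProperty.homMk
            { app := fun _ => ↾fun x => ⟨x, PSh.mem_contElements_of_isContinuous X.property x⟩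
              naturality := fun _ _ _ => rfl }
          naturality := fun _ _ _ => rfl }
      counit :=
        { app := fun X => X.contElements.ι
          naturality := fun _ _ _ => rfl }
      left_triangle := rfl
      right_triangle := rfl }

theorem adjunction_counit_app (X : PSh M) : (adjunction M).counit.app X = X.contElements.ι := rfl

theorem isEquivalence_comparison : (Comonad.comparison (adjunction M)).IsEquivalence :=
  letI : Coreflective (V M) := { R := R M, adj := adjunction M }
  ComonadicLeftAdjoint.eqv (L := V M)

instance preservesFiniteLimits_V : PreservesFiniteLimits (V M) where
  preservesFiniteLimits _ _ _ := inferInstance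

instance hasFiniteLimits : HasFiniteLimits (ContSets M) where
  out _ _ _ := inferInstance

theorem isHyperconnected : (GeometricMorphism.mk (R M) (V M) (adjunction M)
    inferInstance).IsHyperconnected where
  full := inferInstanceAs (V M).Full
  faithful := inferInstanceAs (V M).Faithful
  subobjects X A i _ :=
    ⟨⟨A, PSh.isContinuous_of_injective i (PSh.injective_of_mono i) X.property⟩, ⟨Iso.refl _⟩⟩
  quotients X A p _ :=
    ⟨⟨A, PSh.isContinuous_of_surjective p (PSh.surjective_of_epi p) X.property⟩, ⟨Iso.refl _⟩⟩

/-- The underlying set functor on continuous `M`-sets. -/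
abbrev fiber : ContSets M ⥤ Type u :=
  V M ⋙ (evaluation _ (Type u)).obj (op (SingleObj.star M))

/-- The right adjoint of the underlying set functor. -/
noncomputable def fiberAdjunction :
    fiber M ⊣ evaluationRightAdjoint (Type u) (op (SingleObj.star M)) ⋙ R M :=
  (adjunction M).comp (evaluationAdjunctionLeft (Type u) (op (SingleObj.star M)))

instance : (fiber M).IsLeftAdjoint := (fiberAdjunction M).isLeftAdjoint

instance : PreservesFiniteLimits (fiber M) := comp_preservesFiniteLimits _ _

instance : (fiber M).Faithful where
  map_injective {X Y f g} h := by
    refine ObjectProperty.hom_ext _ (PSh.hom_ext_of_toFun fun x => ?_)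
    exact ConcreteCategory.congr_hom h x

instance : (fiber M).ReflectsIsomorphisms where
  reflects {X Y} f _ := by
    have : IsIso (f.hom.app (op (SingleObj.star M))) := ‹_›
    have : IsIso ((V M).map f) := PSh.isIso_of_isIso_app f.hom
    exact isIso_of_reflects_iso f (V M)

theorem hasEnoughPoints : HasEnoughPoints (ContSets M) :=
  ⟨PUnit, fun _ => ⟨_, fiber M, fiberAdjunction M, inferInstance⟩,
    ⟨fun f h => by
      have : IsIso ((fiber M).map f) := h ⟨⟩
      exact isIso_of_reflects_iso f (fiber M)⟩⟩

/-! ### Epimorphisms, monomorphisms and two-valuedness -/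

variable {M}

theorem surjective_of_epi {X Y : ContSets M} (f : X ⟶ Y) [Epi f] :
    Function.Surjective (PSh.toFun f.hom) :=
  (epi_iff_surjective ((fiber M).map f)).1 inferInstance

theorem epi_of_surjective {X Y : ContSets M} (f : X ⟶ Y)
    (hf : Function.Surjective (PSh.toFun f.hom)) : Epi f :=
  (fiber M).epi_of_epi_map ((epi_iff_surjective _).2 hf)

theorem injective_of_mono {X Y : ContSets M} (f : X ⟶ Y) [Mono f] :
    Function.Injective (PSh.toFun f.hom) :=
  (mono_iff_injective ((fiber M).map f)).1 inferInstance

theorem isIso_of_bijective {X Y : ContSets M} (f : X ⟶ Y)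
    (hf : Function.Bijective (PSh.toFun f.hom)) : IsIso f := by
  have := (isIso_iff_bijective ((fiber M).map f)).2 hf
  exact isIso_of_reflects_iso f (fiber M)

/-- The union of the images and the whole set have characteristic maps into `Prop`. Transposed along
the right adjoint of the underlying set functor, these become morphisms that the family cannot
distinguish. -/
theorem jointlySurjective_of_jointlyEpic {I : Type u} {A : I → ContSets M} {C : ContSets M}
    {f : ∀ i, A i ⟶ C} (hf : JointlyEpic f) (c : C.obj.carrier) :
    ∃ i a, PSh.toFun (f i).hom a = c := by
  let g : (fiber M).obj C ⟶ ULift.{u} Prop := ↾fun _ => ⟨True⟩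
  let h : (fiber M).obj C ⟶ ULift.{u} Prop := ↾fun c => ⟨∃ i a, PSh.toFun (f i).hom a = c⟩
  have hgh : g = h := by
    refine ((fiberAdjunction M).homEquiv _ _).injective (hf _ _ fun i => ?_)
    rw [← Adjunction.homEquiv_naturality_left, ← Adjunction.homEquiv_naturality_left]
    congr 1
    ext a
    exact ⟨fun _ => ⟨i, a, rfl⟩, fun _ => trivial⟩
  have := congrArg ULift.down (ConcreteCategory.congr_hom hgh c)
  exact of_eq_true this.symm

theorem exists_mono_of_isEmpty (T : ContSets M) : ∃ (E : ContSets M) (i : E ⟶ T), Mono i ∧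
    IsEmpty ((fiber M).obj E) := by
  let E : PSh M := PSh.ofAct PEmpty (fun x _ => x) (fun _ => rfl) fun _ _ _ => rfl
  have hE : IsEmpty E.carrier := inferInstanceAs (IsEmpty PEmpty)
  refine ⟨⟨E, (PSh.isContinuous_iff E).2 fun x => hE.elim x⟩,
    ObjectProperty.homMk (PSh.ofEquivariant (fun x => hE.elim x) fun x => hE.elim x), ?_, hE⟩
  exact (fiber M).mono_of_mono_map ((mono_iff_injective _).2 fun x => hE.elim x)

variable (M) in
theorem isTwoValued : IsTwoValued (ContSets M) := by
  refine ⟨⊤_ _, ⟨terminalIsTerminal⟩, ?_⟩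
  have hT : Subsingleton ((fiber M).obj (⊤_ _)) ∧ Nonempty ((fiber M).obj (⊤_ _)) := by
    have t := terminalIsTerminal.isTerminalObj (fiber M) (⊤_ _)
    let e := (t.uniqueUpToIso Types.isTerminalPUnit).toEquiv
    exact ⟨e.subsingleton, ⟨e.symm PUnit.unit⟩⟩
  obtain ⟨hs, ⟨t⟩⟩ := hT
  have htop (S : Subobject (⊤_ ContSets M)) (hS : Nonempty ((fiber M).obj (S : ContSets M))) :
      S = ⊤ := by
    rw [← Subobject.isIso_arrow_iff_eq_top]
    exact isIso_of_bijective _ ⟨injective_of_mono _, fun b => ⟨hS.some, hs.elim _ _⟩⟩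
  have hle (S S' : Subobject (⊤_ ContSets M)) (hS : IsEmpty ((fiber M).obj (S : ContSets M))) :
      S ≤ S' :=
    Subobject.le_of_comm (ObjectProperty.homMk
      (PSh.ofEquivariant (fun x => hS.elim x) fun x => hS.elim x)) (terminalIsTerminal.hom_ext _ _)
  -- The terminal object has a one-point underlying set, so a subobject is classified by whether it
  -- is inhabited.
  rw [Nat.card_eq_of_bijective
    (fun S : Subobject (⊤_ ContSets M) => Nonempty ((fiber M).obj (S : ContSets M)))]
  · simp
  · refine ⟨fun S S' h => ?_, fun p => ?_⟩
    · by_cases hS : Nonempty ((fiber M).obj (S : ContSets M))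
      · rw [htop S hS, htop S' (h.mp hS)]
      · exact le_antisymm (hle _ _ (not_nonempty_iff.1 hS))
          (hle _ _ (not_nonempty_iff.1 fun h' => hS (h.mpr h')))
    · by_cases hp : p
      · exact ⟨⊤, (eq_true ⟨(fiber M).map (inv (⊤ : Subobject (⊤_ ContSets M)).arrow) t⟩).trans
          (eq_true hp).symm⟩
      · obtain ⟨E, i, _, hE⟩ := exists_mono_of_isEmpty (⊤_ ContSets M)
        refine ⟨Subobject.mk i, (eq_false ?_).trans (eq_false hp).symm⟩
        rintro ⟨x⟩
        exact hE.elim ((fiber M).map (Subobject.underlyingIso i).hom x)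

end ContSets

/-! ### Cyclic continuous `M`-sets and supercompactness -/

/-- A right congruence `r` on `M` such that the cyclic right `M`-set `M / r` is continuous. -/
structure ContCongr (M : Type u) [Monoid M] [TopologicalSpace M] extends Setoid M where
  mul_right : ∀ {a b : M} (n : M), r a b → r (a * n) (b * n)
  isOpen : ∀ q p : M, IsOpen {m | r (q * m) (q * p)}

namespace ContCongr

variable {M : Type u} [Monoid M] [TopologicalSpace M]

/-- The cyclic right `M`-set `M / r`. -/
def quot (r : ContCongr M) : PSh M :=
  PSh.ofAct (Quotient r.toSetoid)
    (fun x m => Quotient.map (· * m) (fun _ _ h => r.mul_right m h) x)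
    (fun x => Quotient.inductionOn x fun a => congrArg _ (mul_one a))
    (fun x m n => Quotient.inductionOn x fun a => congrArg _ (mul_assoc a m n).symm)

/-- The cyclic continuous `M`-set `M / r`. -/
def cyc (r : ContCongr M) : ContSets M where
  obj := r.quot
  property := (PSh.isContinuous_iff _).2 fun x p => by
    obtain ⟨q, rfl⟩ := Quotient.mk_surjective x
    convert r.isOpen q p using 1
    ext m
    exact Quotient.eq

/-- The class of an element of `M` in `M / r`. -/
def cls (r : ContCongr M) (a : M) : r.cyc.obj.carrier := Quotient.mk r.toSetoid a

theorem cls_surjective (r : ContCongr M) : Function.Surjective r.cls := Quotient.mk_surjective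

theorem cls_eq_cls {r : ContCongr M} {a b : M} : r.cls a = r.cls b ↔ r.r a b := Quotient.eq

theorem act_cls (r : ContCongr M) (a m : M) : r.cyc.obj.act (r.cls a) m = r.cls (a * m) := rfl

theorem act_cls_one (r : ContCongr M) (m : M) : r.cyc.obj.act (r.cls 1) m = r.cls m := by
  rw [act_cls, one_mul]

/-- The annihilating congruence of an element of a continuous `M`-set. -/
def ker (X : ContSets M) (x : X.obj.carrier) : ContCongr M where
  r a b := X.obj.act x a = X.obj.act x b
  iseqv := ⟨fun _ => rfl, fun h => h.symm, fun h h' => h.trans h'⟩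
  mul_right n h := by rw [PSh.act_mul, PSh.act_mul, h]
  isOpen q p := by
    convert PSh.isOpen_necessaryClopen_of_isContinuous X.property (X.obj.act x q) p using 1
    ext m
    simp only [PSh.necessaryClopen, Set.mem_ofPred_eq, PSh.act_mul]

/-- The intersection of two congruences. -/
def inf (r s : ContCongr M) : ContCongr M where
  r a b := r.r a b ∧ s.r a b
  iseqv := ⟨fun a => ⟨r.iseqv.refl a, s.iseqv.refl a⟩,
    fun h => ⟨r.iseqv.symm h.1, s.iseqv.symm h.2⟩,
    fun h h' => ⟨r.iseqv.trans h.1 h'.1, s.iseqv.trans h.2 h'.2⟩⟩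
  mul_right n h := ⟨r.mul_right n h.1, s.mul_right n h.2⟩
  isOpen q p := (r.isOpen q p).inter (s.isOpen q p)

/-- The preimage of a congruence under left multiplication by `m`. -/
def comap (m : M) (r : ContCongr M) : ContCongr M where
  r a b := r.r (m * a) (m * b)
  iseqv := ⟨fun a => r.iseqv.refl (m * a), fun h => r.iseqv.symm h,
    fun h h' => r.iseqv.trans h h'⟩
  mul_right n h := by simpa only [mul_assoc] using r.mul_right n h
  isOpen q p := by simpa only [mul_assoc] using r.isOpen (m * q) p

section desc

variable {X : ContSets M} {r : ContCongr M}

/-- The morphism `M / r ⟶ X` sending the generator to a given element. -/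
def desc (r : ContCongr M) (x : X.obj.carrier)
    (h : ∀ a b, r.r a b → X.obj.act x a = X.obj.act x b) : r.cyc ⟶ X :=
  ObjectProperty.homMk (PSh.ofEquivariant (X := r.quot)
    (fun y => Quotient.lift (s := r.toSetoid) (fun a => X.obj.act x a) h y)
    (fun y m => Quotient.inductionOn y fun a => PSh.act_mul X.obj x a m))

theorem desc_cls (x : X.obj.carrier) (h : ∀ a b, r.r a b → X.obj.act x a = X.obj.act x b)
    (a : M) : PSh.toFun (desc r x h).hom (r.cls a) = X.obj.act x a := rfl

theorem desc_cls_one (x : X.obj.carrier)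
    (h : ∀ a b, r.r a b → X.obj.act x a = X.obj.act x b) :
    PSh.toFun (desc r x h).hom (r.cls 1) = x :=
  PSh.act_one X.obj x

theorem toFun_cls (f : r.cyc ⟶ X) (a : M) :
    PSh.toFun f.hom (r.cls a) = X.obj.act (PSh.toFun f.hom (r.cls 1)) a := by
  rw [← PSh.toFun_act, act_cls_one]

theorem hom_ext {f g : r.cyc ⟶ X}
    (h : PSh.toFun f.hom (r.cls 1) = PSh.toFun g.hom (r.cls 1)) : f = g := by
  refine ObjectProperty.hom_ext _ (PSh.hom_ext_of_toFun fun x => ?_)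
  obtain ⟨a, rfl⟩ := r.cls_surjective x
  rw [toFun_cls f, toFun_cls g, h]

theorem surjective_of_apply_eq_cls_one {f : X ⟶ r.cyc} {x : X.obj.carrier}
    (h : PSh.toFun f.hom x = r.cls 1) : Function.Surjective (PSh.toFun f.hom) := fun y => by
  obtain ⟨a, rfl⟩ := r.cls_surjective y
  refine ⟨X.obj.act x a, (PSh.toFun_act f.hom x a).trans ?_⟩
  rw [h, act_cls_one]

end desc

/-- The morphism from the cyclic set `M / ker x` onto the orbit of `x`. -/
def orbit (X : ContSets M) (x : X.obj.carrier) : (ker X x).cyc ⟶ X := desc _ x fun _ _ h => h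

theorem orbit_cls_one (X : ContSets M) (x : X.obj.carrier) :
    PSh.toFun (orbit X x).hom ((ker X x).cls 1) = x :=
  desc_cls_one _ _

theorem orbit_injective (X : ContSets M) (x : X.obj.carrier) :
    Function.Injective (PSh.toFun (orbit X x).hom) := fun y z h => by
  obtain ⟨a, rfl⟩ := cls_surjective _ y
  obtain ⟨b, rfl⟩ := cls_surjective _ z
  exact cls_eq_cls.2 h

theorem hom_ext_of_orbit {X Y : ContSets M} {f g : X ⟶ Y}
    (h : ∀ x, orbit X x ≫ f = orbit X x ≫ g) : f = g := by
  refine ObjectProperty.hom_ext _ (PSh.hom_ext_of_toFun fun x => ?_)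
  have := congrArg (fun k => PSh.toFun k.hom ((ker X x).cls 1)) (h x)
  change PSh.toFun f.hom (PSh.toFun (orbit X x).hom ((ker X x).cls 1)) =
    PSh.toFun g.hom (PSh.toFun (orbit X x).hom ((ker X x).cls 1)) at this
  rwa [orbit_cls_one] at this

/-- Some member of the family hits the generator, and then it hits everything. -/
theorem supercompact_cyc (r : ContCongr M) : supercompact (ContSets M) r.cyc := by
  intro I A f hf
  obtain ⟨i, a, h⟩ := ContSets.jointlySurjective_of_jointlyEpic hf (r.cls 1)
  exact ⟨i, ContSets.epi_of_surjective _ (surjective_of_apply_eq_cls_one h)⟩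

/-- The orbit maps are jointly epic, so one of them is epic; being injective as well, it is an
isomorphism. -/
theorem exists_iso_cyc_of_supercompact {X : ContSets M} (hX : supercompact (ContSets M) X) :
    ∃ r : ContCongr M, Nonempty (X ≅ r.cyc) := by
  obtain ⟨x, _⟩ := hX X.obj.carrier (fun x => (ker X x).cyc) (orbit X)
    fun _ _ _ => hom_ext_of_orbit
  have := ContSets.isIso_of_bijective (orbit X x)
    ⟨orbit_injective X x, ContSets.surjective_of_epi _⟩
  exact ⟨ker X x, ⟨(asIso (orbit X x)).symm⟩⟩

end ContCongr

theorem ContSets.isSupercompactlyGenerated (M : Type u) [Monoid M] [TopologicalSpace M] :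
    IsSupercompactlyGenerated (ContSets M) where
  essentiallySmall := ⟨ObjectProperty.ofObj (ContCongr.cyc (M := M)), inferInstance, fun _ hX =>
    have ⟨r, ⟨e⟩⟩ := ContCongr.exists_iso_cyc_of_supercompact hX
    ⟨_, ObjectProperty.ofObj_apply _ r, ⟨e⟩⟩⟩
  isSeparating _ _ _ _ h :=
    ContCongr.hom_ext_of_orbit fun _ => h _ (ContCongr.supercompact_cyc _) _

/-! ### The site of cyclic sets -/

namespace ContCongr

variable {M : Type u} [Monoid M] [TopologicalSpace M]

/-- Continuous congruences form a small category, whose morphisms are the morphisms of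
the associated cyclic sets. -/
instance smallCategory : SmallCategory (ContCongr M) :=
  inferInstanceAs (Category (InducedCategory (ContSets M) cyc))

variable (M) in
/-- The inclusion of the cyclic continuous `M`-sets. -/
def cycFunctor : ContCongr M ⥤ ContSets M where
  obj := cyc
  map f := f.hom

/-- The function underlying a morphism of congruences. -/
abbrev fn {s r : ContCongr M} (f : s ⟶ r) : s.cyc.obj.carrier → r.cyc.obj.carrier :=
  PSh.toFun f.hom.hom

theorem fn_comp {t s r : ContCongr M} (g : t ⟶ s) (f : s ⟶ r) (x : t.cyc.obj.carrier) :
    fn (g ≫ f) x = fn f (fn g x) := rfl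

theorem cat_hom_ext {s r : ContCongr M} {f g : s ⟶ r} (h : fn f (s.cls 1) = fn g (s.cls 1)) :
    f = g :=
  InducedCategory.hom_ext (hom_ext h)

theorem surjective_of_fn_cls_one {s r : ContCongr M} {f : s ⟶ r}
    (h : fn f (s.cls 1) = r.cls 1) : Function.Surjective (fn f) :=
  surjective_of_apply_eq_cls_one h

/-- Left multiplication by `m` as a morphism of congruences. -/
def lmul {s r : ContCongr M} (m : M) (h : ∀ a b, s.r a b → r.r (m * a) (m * b)) : s ⟶ r :=
  InducedCategory.homMk (desc s (X := r.cyc) (r.cls m) fun a b hab => cls_eq_cls.2 (h a b hab))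

theorem fn_lmul_cls_one {s r : ContCongr M} (m : M)
    (h : ∀ a b, s.r a b → r.r (m * a) (m * b)) : fn (lmul m h) (s.cls 1) = r.cls m :=
  desc_cls_one (X := r.cyc) _ _

theorem fn_cls {s r : ContCongr M} (f : s ⟶ r) (a : M) :
    fn f (s.cls a) = r.cyc.obj.act (fn f (s.cls 1)) a :=
  toFun_cls (X := r.cyc) f.hom a

/-- A finer congruence maps to a coarser one. -/
def ofLE {s r : ContCongr M} (h : ∀ a b, s.r a b → r.r a b) : s ⟶ r :=
  lmul 1 (by simpa only [one_mul] using h)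

theorem fn_ofLE_cls_one {s r : ContCongr M} (h : ∀ a b, s.r a b → r.r a b) :
    fn (ofLE h) (s.cls 1) = r.cls 1 :=
  fn_lmul_cls_one _ _

/-- This replaces the pullback, which need not be cyclic: if `f` sends the class of `a` to the image
of the generator of `M / t`, the congruence `t ∩ a⁻¹s` maps to both sides, fixing the generator of
`M / t`. -/
theorem exists_square {r s t : ContCongr M} (f : s ⟶ r) (hf : Function.Surjective (fn f))
    (g : t ⟶ r) : ∃ (u : ContCongr M) (k : u ⟶ t) (h : u ⟶ s),
      Function.Surjective (fn k) ∧ k ≫ g = h ≫ f := by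
  obtain ⟨x, hx⟩ := hf (fn g (t.cls 1))
  obtain ⟨a, rfl⟩ := s.cls_surjective x
  let k : t.inf (s.comap a) ⟶ t := ofLE fun _ _ h => h.1
  let h : t.inf (s.comap a) ⟶ s := lmul a fun _ _ h => h.2
  have hk : fn k (cls _ 1) = t.cls 1 := fn_ofLE_cls_one _
  have hh : fn h (cls _ 1) = s.cls a := fn_lmul_cls_one _ _
  refine ⟨_, k, h, surjective_of_fn_cls_one hk, cat_hom_ext ?_⟩
  rw [fn_comp, fn_comp, hk, hh, hx]

variable (M) in
/-- The topology whose covering sieves are those containing a surjection. -/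
def topology : GrothendieckTopology (ContCongr M) where
  sieves r := {S | ∃ (s : ContCongr M) (f : s ⟶ r), S f ∧ Function.Surjective (fn f)}
  top_mem' r := ⟨r, 𝟙 r, trivial, Function.surjective_id⟩
  pullback_stable' := by
    rintro r t S g ⟨s, f, hS, hf⟩
    obtain ⟨u, k, h, hk, e⟩ := exists_square f hf g
    refine ⟨u, k, ?_, hk⟩
    change S (k ≫ g)
    rw [e]
    exact S.downward_closed hS h
  transitive' := by
    rintro r S ⟨s, f, hS, hf⟩ R hR
    obtain ⟨t, g, hg, hg'⟩ := hR hS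
    exact ⟨t, g ≫ f, hg, hf.comp hg'⟩

/-! ### Descent along surjections and the fully faithful nerve -/

theorem exists_desc_of_surjective {r s : ContCongr M} {X : ContSets M} (f : s ⟶ r)
    (hf : Function.Surjective (fn f)) (φ : s.cyc ⟶ X)
    (h : ∀ a b, fn f a = fn f b → PSh.toFun φ.hom a = PSh.toFun φ.hom b) :
    ∃ ψ : r.cyc ⟶ X, f.hom ≫ ψ = φ := by
  -- The map `f` need not preserve generators, so `ψ` is defined on the generator of `M / r` through
  -- a chosen lift `b`.
  obtain ⟨b, hb⟩ := hf (r.cls 1)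
  have hbp (p : M) : fn f (s.cyc.obj.act b p) = r.cls p := by
    rw [fn, PSh.toFun_act, ← r.act_cls_one p]
    exact congrArg (fun y => r.cyc.obj.act y p) hb
  let ψ : r.cyc ⟶ X := desc r (PSh.toFun φ.hom b) fun p q hpq => by
    rw [← PSh.toFun_act, ← PSh.toFun_act]
    exact h _ _ (by rw [hbp, hbp, cls_eq_cls.2 hpq])
  refine ⟨ψ, hom_ext ?_⟩
  obtain ⟨p, hp⟩ := r.cls_surjective (fn f (s.cls 1))
  change PSh.toFun ψ.hom (fn f (s.cls 1)) = _
  rw [← hp, desc_cls, ← PSh.toFun_act]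
  exact h _ _ (by rw [hbp, hp])

theorem epi_of_surjective {r s : ContCongr M} (f : s ⟶ r)
    (hf : Function.Surjective (fn f)) : Epi f.hom :=
  ContSets.epi_of_surjective _ hf

/-- The presheaf of morphisms from cyclic sets to a continuous `M`-set. -/
abbrev homPresheaf (X : ContSets M) : (ContCongr M)ᵒᵖ ⥤ Type u :=
  (cycFunctor M).op ⋙ yoneda.obj X

theorem isSheaf_homPresheaf (X : ContSets M) : Presieve.IsSheaf (topology M) (homPresheaf X) := by
  rintro r S ⟨s, f, hS, hf⟩ x hx
  have hcomp {t t' u : ContCongr M} (g : t ⟶ r) (hg : S g) (g' : t' ⟶ r) (hg' : S g')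
      (k : u ⟶ t) (k' : u ⟶ t') (e : k ≫ g = k' ≫ g') :
      k.hom ≫ (x g hg : t.cyc ⟶ X) = k'.hom ≫ (x g' hg' : t'.cyc ⟶ X) := hx k k' hg hg' e
  obtain ⟨ψ, hψ⟩ := exists_desc_of_surjective f hf (x f hS) fun y z hyz => by
    obtain ⟨a, rfl⟩ := s.cls_surjective y
    obtain ⟨b, rfl⟩ := s.cls_surjective z
    -- Two points with the same image under `f` are the images of one generator under `k` and `k'`;
    -- compatibility along this pair makes `x f` constant on the fibres of `f`.
    let k : (s.comap a).inf (s.comap b) ⟶ s := lmul a fun _ _ h => h.1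
    let k' : (s.comap a).inf (s.comap b) ⟶ s := lmul b fun _ _ h => h.2
    have hk : fn k (cls _ 1) = s.cls a := fn_lmul_cls_one _ _
    have hk' : fn k' (cls _ 1) = s.cls b := fn_lmul_cls_one _ _
    have e := hcomp f hS f hS k k' (cat_hom_ext (by rw [fn_comp, fn_comp, hk, hk', hyz]))
    have e' := congrArg (fun l => PSh.toFun l.hom (cls _ 1)) e
    rw [← hk, ← hk']
    exact e'
  refine ⟨ψ, fun t g hg => ?_, fun ψ' hψ' => ?_⟩
  · obtain ⟨u, k, h, hk, e⟩ := exists_square f hf g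
    have := epi_of_surjective k hk
    refine (cancel_epi k.hom).1 (Eq.trans ?_ (hcomp g hg f hS k h e).symm)
    rw [← hψ]
    exact congrArg (fun l : u ⟶ r => l.hom ≫ ψ) e
  · have := epi_of_surjective f hf
    exact (cancel_epi f.hom).1 ((hψ' f hS).trans hψ.symm)

variable (M) in
/-- The functor from continuous `M`-sets to sheaves on the site of cyclic continuous `M`-sets. -/
def nerve : ContSets M ⥤ Sheaf (topology M) (Type u) where
  obj X := ⟨homPresheaf X, (isSheaf_iff_isSheaf_of_type _ _).2 (isSheaf_homPresheaf X)⟩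
  map f := ObjectProperty.homMk (Functor.whiskerLeft _ (yoneda.map f))

instance : (nerve M).Faithful where
  map_injective {X _ _ _} h := hom_ext_of_orbit fun x =>
    ConcreteCategory.congr_hom (NatTrans.congr_app (congrArg (·.hom) h) (op (ker X x)))
      (orbit X x)

instance : (nerve M).Full where
  map_surjective {X Y} φ := by
    let φ' (r : ContCongr M) (k : r.cyc ⟶ X) : r.cyc ⟶ Y := φ.hom.app (op r) k
    have hφ {r s : ContCongr M} (f : s ⟶ r) (k : r.cyc ⟶ X) :
        φ' s (f.hom ≫ k) = f.hom ≫ φ' r k := NatTrans.naturality_apply φ.hom f.op k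
    -- This value is forced, since `x` is the image of the generator under its orbit map.
    let F (x : X.obj.carrier) : Y.obj.carrier := PSh.toFun (φ' _ (orbit X x)).hom (cls _ 1)
    have hF {r : ContCongr M} (k : r.cyc ⟶ X) (a : M) :
        F (PSh.toFun k.hom (r.cls a)) = PSh.toFun (φ' r k).hom (r.cls a) := by
      have hle : ∀ b c, (ker X (PSh.toFun k.hom (r.cls a))).r b c ↔
          PSh.toFun k.hom (r.cls (a * b)) = PSh.toFun k.hom (r.cls (a * c)) := fun b c => by
        rw [← act_cls, ← act_cls, PSh.toFun_act, PSh.toFun_act]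
        rfl
      -- Over `a⁻¹r`, the orbit map at `k(a)` agrees with `k` preceded by left multiplication by
      -- `a`; naturality of `φ` along both gives the claim.
      let i : r.comap a ⟶ ker X (PSh.toFun k.hom (r.cls a)) :=
        ofLE fun b c h => (hle b c).2 (congrArg _ (cls_eq_cls (r := r).2 h))
      let l : r.comap a ⟶ r := lmul a fun _ _ h => h
      have hi : fn i (cls _ 1) = cls _ 1 := fn_ofLE_cls_one _
      have hl : fn l (cls _ 1) = cls _ a := fn_lmul_cls_one _ _
      have e : i.hom ≫ orbit X (PSh.toFun k.hom (r.cls a)) = l.hom ≫ k := by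
        refine hom_ext ?_
        change PSh.toFun (orbit X _).hom (fn i (cls _ 1)) = PSh.toFun k.hom (fn l (cls _ 1))
        rw [hi, hl, orbit_cls_one]
      have e' := congrArg (fun q => PSh.toFun (φ' _ q).hom (cls _ 1)) e
      simp only [hφ] at e'
      change PSh.toFun (φ' _ (orbit X _)).hom (fn i (cls _ 1)) =
        PSh.toFun (φ' _ k).hom (fn l (cls _ 1)) at e'
      rwa [hi, hl] at e'
    refine ⟨ObjectProperty.homMk (PSh.ofEquivariant F fun x m => ?_), ?_⟩
    · have h := hF (orbit X x) m
      rw [toFun_cls (orbit X x), toFun_cls (φ' _ _), orbit_cls_one] at h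
      exact h
    · refine ObjectProperty.hom_ext _ (NatTrans.ext (funext fun r => ?_))
      refine ConcreteCategory.hom_ext _ _ fun k => ?_
      exact hom_ext (hF (r := r.unop) k 1)

end ContCongr

/-! ### Reconstructing a continuous `M`-set from a sheaf -/

namespace ContCongr

variable {M : Type u} [Monoid M] [TopologicalSpace M] (P : (ContCongr M)ᵒᵖ ⥤ Type u)

/-- Sections of `P` over `M / r` and `M / s` are identified if they agree on `M / t` for some
common refinement `t` of `r` and `s`. -/
def glueSetoid : Setoid (Σ r : ContCongr M, P.obj (op r)) where
  r x y := ∃ (t : ContCongr M) (i : t ⟶ x.1) (j : t ⟶ y.1), fn i (t.cls 1) = x.1.cls 1 ∧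
    fn j (t.cls 1) = y.1.cls 1 ∧ P.map i.op x.2 = P.map j.op y.2
  iseqv :=
    { refl := fun x => ⟨x.1, 𝟙 _, 𝟙 _, rfl, rfl, rfl⟩
      symm := fun ⟨t, i, j, hi, hj, h⟩ => ⟨t, j, i, hj, hi, h.symm⟩
      trans := fun {x y z} ⟨t, i, j, hi, hj, h⟩ ⟨t', i', j', hi', hj', h'⟩ => by
        let k : t.inf t' ⟶ t := ofLE fun _ _ h => h.1
        let k' : t.inf t' ⟶ t' := ofLE fun _ _ h => h.2
        have hk : fn k (cls _ 1) = t.cls 1 := fn_ofLE_cls_one _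
        have hk' : fn k' (cls _ 1) = t'.cls 1 := fn_ofLE_cls_one _
        have e : k ≫ j = k' ≫ i' := cat_hom_ext (by rw [fn_comp, fn_comp, hk, hk', hj, hi'])
        refine ⟨t.inf t', k ≫ i, k' ≫ j', by rw [fn_comp, hk, hi], by rw [fn_comp, hk', hj'], ?_⟩
        rw [op_comp, op_comp, Functor.map_comp_apply, Functor.map_comp_apply, h, ← h',
          ← Functor.map_comp_apply, ← Functor.map_comp_apply, ← op_comp, ← op_comp, e] }

/-- The filtered colimit of the sections of `P` over all cyclic sets `M / r`. -/
def Glue : Type u := Quotient (glueSetoid P)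

variable {P}

/-- The element of the colimit represented by a section. -/
def Glue.mk {r : ContCongr M} (x : P.obj (op r)) : Glue P := Quotient.mk (glueSetoid P) ⟨r, x⟩

theorem Glue.exists_mk (z : Glue P) :
    ∃ (r : ContCongr M) (x : P.obj (op r)), Glue.mk x = z :=
  Quotient.inductionOn z fun x => ⟨x.1, x.2, rfl⟩

theorem Glue.mk_eq_mk {r s : ContCongr M} {x : P.obj (op r)} {y : P.obj (op s)} :
    Glue.mk x = Glue.mk y ↔ ∃ (t : ContCongr M) (i : t ⟶ r) (j : t ⟶ s),
      fn i (t.cls 1) = r.cls 1 ∧ fn j (t.cls 1) = s.cls 1 ∧ P.map i.op x = P.map j.op y :=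
  Quotient.eq

/-- The projection of `M / m⁻¹r` to `M / r` given by left multiplication. -/
def comapHom (m : M) (r : ContCongr M) : r.comap m ⟶ r := lmul m fun _ _ h => h

theorem fn_comapHom_cls_one (m : M) (r : ContCongr M) :
    fn (comapHom m r) (cls _ 1) = r.cls m := fn_lmul_cls_one _ _

/-- This makes the germ of a restriction along `f` depend only on where `f` sends the generator, so
the action on germs is well defined. -/
theorem comap_factor {s r : ContCongr M} (f : s ⟶ r) {a : M} (hf : fn f (s.cls 1) = r.cls a) :
    ∃ k : s ⟶ r.comap a, fn k (s.cls 1) = cls _ 1 ∧ k ≫ comapHom a r = f := by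
  let k : s ⟶ r.comap a := ofLE fun b c h => by
    have e := congrArg (fn f) (cls_eq_cls.2 h)
    rw [fn_cls f b, fn_cls f c, hf, act_cls, act_cls] at e
    exact cls_eq_cls (r := r).1 e
  have hk : fn k (s.cls 1) = cls _ 1 := fn_ofLE_cls_one _
  exact ⟨k, hk, cat_hom_ext (by rw [fn_comp, hk, hf, fn_comapHom_cls_one])⟩

theorem Glue.mk_map_eq {s r : ContCongr M} (f : s ⟶ r) {a : M} (hf : fn f (s.cls 1) = r.cls a)
    (x : P.obj (op r)) : Glue.mk (P.map f.op x) = Glue.mk (P.map (comapHom a r).op x) := by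
  obtain ⟨k, hk, rfl⟩ := comap_factor f hf
  refine Glue.mk_eq_mk.2 ⟨s, 𝟙 s, k, rfl, hk, ?_⟩
  rw [op_comp, Functor.map_comp_apply, op_id, Functor.map_id_apply]

/-- The right action of `M` on the colimit. -/
def Glue.act (z : Glue P) (m : M) : Glue P :=
  Quotient.lift (s := glueSetoid P) (fun x => Glue.mk (P.map (comapHom m x.1).op x.2))
    (by
      rintro ⟨r, x⟩ ⟨s, y⟩ ⟨t, i, j, hi, hj, h⟩
      change Glue.mk (P.map (comapHom m r).op x) = Glue.mk (P.map (comapHom m s).op y)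
      have key {q : ContCongr M} (i : t ⟶ q) (hi : fn i (t.cls 1) = q.cls 1) :
          fn (comapHom m t ≫ i) (cls _ 1) = q.cls m := by
        rw [fn_comp, fn_comapHom_cls_one, fn_cls, hi, act_cls_one]
      rw [← Glue.mk_map_eq _ (key i hi), ← Glue.mk_map_eq _ (key j hj), op_comp, op_comp,
        Functor.map_comp_apply, Functor.map_comp_apply]
      exact congrArg (fun w => Glue.mk (P.map (comapHom m t).op w)) h) z

theorem Glue.mk_map {s r : ContCongr M} (f : s ⟶ r) {a : M} (hf : fn f (s.cls 1) = r.cls a)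
    (x : P.obj (op r)) : Glue.mk (P.map f.op x) = (Glue.mk x).act a :=
  Glue.mk_map_eq f hf x

theorem Glue.act_one (z : Glue P) : z.act 1 = z := by
  obtain ⟨r, x, rfl⟩ := z.exists_mk
  rw [← Glue.mk_map (𝟙 r) rfl, op_id, Functor.map_id_apply]

theorem Glue.act_mul (z : Glue P) (m n : M) : z.act (m * n) = (z.act m).act n := by
  obtain ⟨r, x, rfl⟩ := z.exists_mk
  rw [← Glue.mk_map (comapHom m r) (fn_comapHom_cls_one m r),
    ← Glue.mk_map (comapHom n _) (fn_comapHom_cls_one n _), ← Functor.map_comp_apply, ← op_comp]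
  refine (Glue.mk_map _ ?_ x).symm
  rw [fn_comp, fn_comapHom_cls_one, fn_cls, fn_comapHom_cls_one, act_cls]

/-- Left multiplication by `a` sends the generator to a class also represented by `b`. Hence the
classes of a germ over `M / r` are unions of the open classes of `r`, making `glue P` continuous. -/
theorem Glue.act_eq_act {r : ContCongr M} (x : P.obj (op r)) {a b : M} (h : r.r a b) :
    (Glue.mk x).act a = (Glue.mk x).act b := by
  rw [← Glue.mk_map (comapHom a r) (fn_comapHom_cls_one a r)]
  exact Glue.mk_map _ ((fn_comapHom_cls_one a r).trans (cls_eq_cls.2 h)) x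

theorem Glue.mk_map_of_fn_cls_one {s r : ContCongr M} (f : s ⟶ r)
    (hf : fn f (s.cls 1) = r.cls 1) (x : P.obj (op r)) : Glue.mk (P.map f.op x) = Glue.mk x := by
  rw [Glue.mk_map f hf, Glue.act_one]

variable (P) in
/-- The continuous `M`-set whose elements are germs of sections of `P`. -/
def glue : ContSets M where
  obj := PSh.ofAct (Glue P) Glue.act Glue.act_one Glue.act_mul
  property := (PSh.isContinuous_iff _).2 fun z p => by
    obtain ⟨r, x, rfl⟩ := Glue.exists_mk z
    refine isOpen_iff_forall_mem_open.mpr fun m hm => ⟨{n | r.r n m}, fun n hn => ?_, ?_,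
      r.iseqv.refl m⟩
    · exact (Glue.act_eq_act x hn).trans hm
    · simpa only [one_mul] using r.isOpen 1 m

theorem isSheafFor_singleton_of_surjective (hP : Presieve.IsSheaf (topology M) P) {s r : ContCongr M}
    (f : s ⟶ r) (hf : Function.Surjective (fn f)) : (Presieve.singleton f).IsSheafFor P :=
  (Presieve.isSheafFor_iff_generate _).2
    (hP _ ⟨s, f, ⟨s, 𝟙 s, f, Presieve.singleton_self f, Category.id_comp f⟩, hf⟩)

theorem map_injective_of_surjective (hP : Presieve.IsSheaf (topology M) P) {s r : ContCongr M}
    (f : s ⟶ r) (hf : Function.Surjective (fn f)) : Function.Injective (P.map f.op) := by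
  intro x y h
  refine (isSheafFor_singleton_of_surjective hP f hf).isSeparatedFor.ext fun _ _ hg => ?_
  cases hg
  exact h

/-- Two generator-preserving maps into the same `M / r` coincide and are surjective, and a sheaf is
separated for surjections. -/
theorem Glue.mk_injective (hP : Presieve.IsSheaf (topology M) P) {r : ContCongr M} :
    Function.Injective (Glue.mk : P.obj (op r) → Glue P) := by
  intro x y h
  obtain ⟨t, i, j, hi, hj, h⟩ := Glue.mk_eq_mk.1 h
  obtain rfl : i = j := cat_hom_ext (hi.trans hj.symm)
  exact map_injective_of_surjective hP i (surjective_of_fn_cls_one hi) h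

variable (P) in
/-- Sections of `P` over `M / r` define morphisms from `M / r` to the glued `M`-set. -/
def toHomGlue : P ⟶ homPresheaf (glue P) where
  app r := ↾fun x => desc r.unop (X := glue P) (Glue.mk x) fun _ _ h => Glue.act_eq_act x h
  naturality r s f := by
    refine ConcreteCategory.hom_ext _ _ fun x => ?_
    refine hom_ext (X := glue P) ?_
    refine (desc_cls_one (X := glue P) _ _).trans ?_
    obtain ⟨a, ha⟩ := cls_surjective _ (fn f.unop (cls _ 1))
    refine (Glue.mk_map f.unop ha.symm x).trans ?_
    exact congrArg (PSh.toFun (desc r.unop (X := glue P) (Glue.mk x)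
      fun _ _ h => Glue.act_eq_act x h).hom) ha

theorem toHomGlue_app_bijective (hP : Presieve.IsSheaf (topology M) P) (r : ContCongr M) :
    Function.Bijective ((toHomGlue P).app (op r)) := by
  refine ⟨fun x y h => Glue.mk_injective hP ?_, fun ψ => ?_⟩
  · have := congrArg (fun k : r.cyc ⟶ glue P => PSh.toFun k.hom (r.cls 1)) h
    exact (desc_cls_one (X := glue P) _ _).symm.trans (this.trans (desc_cls_one (X := glue P) _ _))
  · change r.cyc ⟶ glue P at ψ
    obtain ⟨s, y, hy⟩ := Glue.exists_mk (PSh.toFun ψ.hom (r.cls 1))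
    let f : r.inf s ⟶ r := ofLE fun _ _ h => h.1
    let g : r.inf s ⟶ s := ofLE fun _ _ h => h.2
    have hf : fn f (cls _ 1) = r.cls 1 := fn_ofLE_cls_one _
    have hg : fn g (cls _ 1) = s.cls 1 := fn_ofLE_cls_one _
    rw [← Glue.mk_map_of_fn_cls_one g hg] at hy
    -- The germ of a restriction along `p` depends only on `p ≫ f`. As germs determine sections,
    -- this is the matching condition for descending `P.map g.op y` along `f`.
    have hmap {u : ContCongr M} (p : u ⟶ r.inf s) :
        Glue.mk (P.map p.op (P.map g.op y)) = PSh.toFun ψ.hom (fn (p ≫ f) (u.cls 1)) := by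
      obtain ⟨a, ha⟩ := cls_surjective _ (fn p (cls _ 1))
      rw [Glue.mk_map p ha.symm, hy, fn_comp, ← ha, fn_cls, hf, act_cls_one, toFun_cls ψ a]
      rfl
    obtain ⟨w, hw, -⟩ := Presieve.isSheafFor_singleton.1
      (isSheafFor_singleton_of_surjective hP f (surjective_of_fn_cls_one hf)) (P.map g.op y)
      fun p₁ p₂ h => Glue.mk_injective hP (by rw [hmap, hmap, h])
    refine ⟨w, hom_ext (X := glue P) ((desc_cls_one (X := glue P) _ _).trans ?_)⟩
    rw [← Glue.mk_map_of_fn_cls_one f hf, hw, hy]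

instance : (nerve M).EssSurj where
  mem_essImage P := by
    have hP := (isSheaf_iff_isSheaf_of_type _ _).1 P.property
    have : ∀ r, IsIso ((toHomGlue P.obj).app r) := fun r =>
      (isIso_iff_bijective _).2 (toHomGlue_app_bijective hP r.unop)
    have := NatIso.isIso_of_isIso_app (toHomGlue P.obj)
    let e : P.obj ≅ homPresheaf (glue P.obj) := asIso (toHomGlue P.obj)
    exact ⟨glue P.obj, ⟨ObjectProperty.isoMk _ e.symm⟩⟩

instance : (nerve M).IsEquivalence where

end ContCongr

/-! ### Topos structure and conclusion -/

namespace ContSets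

variable (M : Type u) [Monoid M] [TopologicalSpace M]

theorem isGrothendieckTopos : IsGrothendieckTopos (ContSets M) :=
  ⟨ContCongr M, inferInstance, ContCongr.topology M, ⟨(ContCongr.nerve M).asEquivalence⟩⟩

end ContSets

theorem IsGrothendieckTopos.isElementaryTopos {E : Type w} [Category.{v} E]
    (h : IsGrothendieckTopos E) : IsElementaryTopos E := by
  obtain ⟨C, _, J, ⟨e⟩⟩ := h
  have : HasFiniteLimits E := ⟨fun _ _ _ =>
    Adjunction.hasLimitsOfShape_of_equivalence e.functor⟩
  let _ : CartesianMonoidalCategory E := .ofHasFiniteProducts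
  have closed : MonoidalClosed (Sheaf J (Type v)) := inferInstance
  refine ⟨inferInstance, ⟨inferInstance, ⟨?_⟩⟩, ?_⟩
  · exact @cartesianClosedOfEquiv (Sheaf J (Type v)) _ CartesianMonoidalCategory.fullSubcategory
      E _ _ e.symm closed
  exact ⟨⟨(HasSubobjectClassifier.exists_classifier (C := Sheaf J (Type v))).some.ofEquivalence
    e.symm⟩⟩

theorem mainTheorem1 (M : Type u) [Monoid M] [TopologicalSpace M] :
    -- `V` is left exact and comonadic with right adjoint `R`, the counit being the inclusion
    -- of the continuous elements, and `V ⊣ R` is a hyperconnected geometric morphism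
    (∃ (leftExact : PreservesFiniteLimits (ContSets.V M)) (adj : ContSets.V M ⊣ ContSets.R M),
      (∀ X : PSh M, adj.counit.app X = X.contElements.ι) ∧
      (Comonad.comparison adj).IsEquivalence ∧
      (GeometricMorphism.mk (ContSets.R M) (ContSets.V M) adj leftExact).IsHyperconnected) ∧
    -- the continuous elements in terms of open relations
    (∀ (X : PSh M) (x : X.carrier),
      x ∈ X.contElements.obj (op (SingleObj.star M)) ↔ ∀ q : M, IsOpen (X.rel (X.act x q))) ∧
    -- simplified expressions when every left multiplication is continuous
    ((∀ q : M, Continuous fun m : M => q * m) → ∀ (X : PSh M) (x : X.carrier),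
      (x ∈ X.contElements.obj (op (SingleObj.star M)) ↔
        ∀ p : M, IsOpen (X.necessaryClopen x p)) ∧
      (x ∈ X.contElements.obj (op (SingleObj.star M)) ↔ IsOpen (X.rel x))) ∧
    IsElementaryTopos (ContSets M) ∧
    IsGrothendieckTopos (ContSets M) ∧
    IsSupercompactlyGenerated (ContSets M) ∧
    IsTwoValued (ContSets M) ∧
    HasEnoughPoints (ContSets M) :=
  ⟨⟨inferInstance, ContSets.adjunction M, ContSets.adjunction_counit_app M,
      ContSets.isEquivalence_comparison M, ContSets.isHyperconnected M⟩,
    PSh.mem_contElements_iff_rel,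
    fun hM X x => ⟨PSh.mem_contElements_iff_of_continuous_mul hM X x,
      PSh.mem_contElements_iff_isOpen_rel hM X x⟩,
    (ContSets.isGrothendieckTopos M).isElementaryTopos,
    ContSets.isGrothendieckTopos M,
    ContSets.isSupercompactlyGenerated M,
    ContSets.isTwoValued M,
    ContSets.hasEnoughPoints M⟩
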